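/- Let $N\ge 1$ and let $\mathbb R^{2N-1}$ have coordinates $(a_1,\dots,a_{N-1},b_1,\dots,b_N)$, with $a_n=0$ for $n\notin\{1,\dots,N-1\}$ and $b_n=0$ for $n\notin\{1,\dots,N\}$. Let $L$ be the symmetric tridiagonal $N\times N$ matrix with diagonal $b_1,\dots,b_N$ and off-diagonal entries $L_{i,i+1}=L_{i+1,i}=a_i$, and let $H_i=\frac1i\operatorname{Tr}L^i$ for $i\ge1$. The first three Toda brackets are given by (all brackets of coordinates that are not determined by antisymmetry from those listed are zero; indices run over the values for which the coordinates on the left-hand side exist) * $\pi_1$: $\{a_i,b_i\}=-a_i$, $\{a_i,b_{i+1}\}=a_i$; * $\pi_2$: $\{a_i,a_{i+1}\}=\frac12a_ia_{i+1}$, $\{a_i,b_i\}=-a_ib_i$, $\{a_i,b_{i+1}\}=a_ib_{i+1}$, $\{b_i,b_{i+1}\}=2a_i^2$; * $\pi_3$: $\{a_i,a_{i+1}\}=a_ia_{i+1}b_{i+1}$, $\{a_i,b_i\}=-a_ib_i^2-a_i^3$, $\{a_i,b_{i+1}\}=a_ib_{i+1}^2+a_i^3$, $\{a_i,b_{i+2}\}=a_ia_{i+1}^2$,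 $\{a_{i+1},b_i\}=-a_i^2a_{i+1}$, $\{b_i,b_{i+1}\}=2a_i^2(b_i+b_{i+1})$. Let $X_1=\sum_{n=1}^{N-1}\dot a_n\,\partial/\partial a_n+\sum_{n=1}^{N}\dot b_n\,\partial/\partial b_n$ with $\dot a_n=-na_nb_n+(n+2)a_nb_{n+1}$ and $\dot b_n=(2n+3)a_n^2+(1-2n)a_{n-1}^2+b_n^2$. Let $X_2$ be any smooth vector field on $\mathbb R^{2N-1}$ that is given by an equation $\dot L=[B,L]+L^3$ for some matrix $B$ depending on the point (such fields exist), and define $X_n$ for $n\ge3$ by $[X_1,X_{n-1}]=(n-2)X_n$. Call a 2-tensor trivial if every $H_l$, $l\ge1$, is a Casimir of it. The hierarchy is the smallest family of contravariant antisymmetric 2-tensors, each with a level $n\ge1$, that contains $\pi_1,\pi_2,\pi_3$ (at the levels $1,2,3$) and contains, at the level $m+k$, with each member $\pi_m$ of level $m$ and each $k\ge1$ with $m\ne k+2$, every smooth antisymmetric 2-tensor $\pi_{m+k}$ satisfying $L_{X_k}\pi_m=(m-k-2)\,\pi_{m+k}$ up to a trivial tensor, where $L_{X_k}$ is the Lie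 derivative. Then for every $n\ge1$ and every tensor $\pi_n$ of level $n$ in the hierarchy, the functions $H_i$ are pairwise in involution with respect to the bracket $\{\,\cdot\,,\cdot\,\}_n$ of $\pi_n$: $\{H_i,H_j\}_n=0$ on $\mathbb R^{2N-1}$ for all $i,j\ge1$. -/

import Mathlib

open scoped ContDiff

noncomputable section

namespace Toda

/-- Index set of the coordinates `a_1, …, a_{N-1}` (left) and `b_1, …, b_N` (right); the element
with value `k` of each `Fin` stands for the coordinate with the (1-based) number `k + 1`. -/
abbrev Idx (N : ℕ) : Type := Fin (N - 1) ⊕ Fin N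

/-- The phase space `ℝ^{2N-1}` of Flaschka variables `(a_1, …, a_{N-1}, b_1, …, b_N)`. -/
abbrev Space (N : ℕ) : Type := Idx N → ℝ

/-- Vector fields on `ℝ^{2N-1}`. -/
abbrev VField (N : ℕ) : Type := Space N → Space N

/-- Contravariant 2-tensor fields on `ℝ^{2N-1}`, given by their matrix of coefficients
`P x i j = {x_i, x_j}(x)`. -/
abbrev Tensor (N : ℕ) : Type := Space N → Matrix (Idx N) (Idx N) ℝ

variable {N : ℕ}

/-- The coordinate `a_n`, `1 ≤ n ≤ N - 1`, with the convention `a_n = 0` for other `n`. -/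
def a (x : Space N) (n : ℕ) : ℝ :=
  if h : 1 ≤ n ∧ n < N then x (Sum.inl ⟨n - 1, by omega⟩) else 0

/-- The coordinate `b_n`, `1 ≤ n ≤ N`, with the convention `b_n = 0` for other `n`. -/
def b (x : Space N) (n : ℕ) : ℝ :=
  if h : 1 ≤ n ∧ n ≤ N then x (Sum.inr ⟨n - 1, by omega⟩) else 0

/-- The Jacobi matrix `L`: diagonal `b_1, …, b_N`, both off-diagonals `a_1, …, a_{N-1}`. -/
def L (x : Space N) : Matrix (Fin N) (Fin N) ℝ := fun i j =>
  if i = j then b x (i + 1)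
  else if (i : ℕ) + 1 = j then a x (i + 1)
  else if (j : ℕ) + 1 = i then a x (j + 1)
  else 0

/-- The Toda integrals `H_i = (1/i) Tr L^i`. -/
def H (N i : ℕ) (x : Space N) : ℝ := (1 / (i : ℝ)) * (L x ^ i).trace

/-- The gradient `(∂f/∂x_i)_i`. -/
def grad (f : Space N → ℝ) (x : Space N) : Space N := fun i => fderiv ℝ f x (Pi.single i 1)

/-- The bracket `{f, g} = ∑ P^{ij} ∂_i f ∂_j g` of the tensor `P`. -/
def bracket (P : Tensor N) (f g : Space N → ℝ) (x : Space N) : ℝ :=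
  ∑ i, ∑ j, P x i j * grad f x i * grad g x j

/-- The antisymmetric matrix with prescribed entries `{a_i, a_j}` (for `i < j`), `{a_i, b_j}` and
`{b_i, b_j}` (for `i < j`), indices being 1-based. -/
def skew (aa ab bb : ℕ → ℕ → ℝ) : Matrix (Idx N) (Idx N) ℝ
  | .inl i, .inl j =>
      if i < j then aa (i + 1) (j + 1) else if j < i then -aa (j + 1) (i + 1) else 0
  | .inl i, .inr j => ab (i + 1) (j + 1)
  | .inr i, .inl j => -ab (j + 1) (i + 1)
  | .inr i, .inr j =>
      if i < j then bb (i + 1) (j + 1) else if j < i then -bb (j + 1) (i + 1) else 0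

/-- The linear Toda bracket: `{a_i, b_i} = -a_i`, `{a_i, b_{i+1}} = a_i`. -/
def linear (N : ℕ) : Tensor N := fun x => skew
  (fun _ _ => 0)
  (fun i j => if j = i then -a x i else if j = i + 1 then a x i else 0)
  (fun _ _ => 0)

/-- The quadratic Toda bracket: `{a_i, a_{i+1}} = a_i a_{i+1} / 2`, `{a_i, b_i} = -a_i b_i`,
`{a_i, b_{i+1}} = a_i b_{i+1}`, `{b_i, b_{i+1}} = 2 a_i^2`. -/
def quadratic (N : ℕ) : Tensor N := fun x => skew
  (fun i j => if j = i + 1 then 1 / 2 * a x i * a x (i + 1) else 0)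
  (fun i j => if j = i then -a x i * b x i else if j = i + 1 then a x i * b x (i + 1) else 0)
  (fun i j => if j = i + 1 then 2 * a x i ^ 2 else 0)

/-- The cubic Toda bracket: `{a_i, a_{i+1}} = a_i a_{i+1} b_{i+1}`,
`{a_i, b_i} = -a_i b_i^2 - a_i^3`, `{a_i, b_{i+1}} = a_i b_{i+1}^2 + a_i^3`,
`{a_i, b_{i+2}} = a_i a_{i+1}^2`, `{a_{i+1}, b_i} = -a_i^2 a_{i+1}`,
`{b_i, b_{i+1}} = 2 a_i^2 (b_i + b_{i+1})`. -/
def cubic (N : ℕ) : Tensor N := fun x => skew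
  (fun i j => if j = i + 1 then a x i * a x (i + 1) * b x (i + 1) else 0)
  (fun i j =>
    if j = i then -a x i * b x i ^ 2 - a x i ^ 3
    else if j = i + 1 then a x i * b x (i + 1) ^ 2 + a x i ^ 3
    else if j = i + 2 then a x i * a x (i + 1) ^ 2
    else if i = j + 1 then -a x j ^ 2 * a x (j + 1)
    else 0)
  (fun i j => if j = i + 1 then 2 * a x i ^ 2 * (b x i + b x (i + 1)) else 0)

/-- `ȧ_n = -n a_n b_n + (n + 2) a_n b_{n+1}`. -/
def adot (x : Space N) (n : ℕ) : ℝ :=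
  -(n : ℝ) * a x n * b x n + ((n : ℝ) + 2) * a x n * b x (n + 1)

/-- `ḃ_n = (2n + 3) a_n^2 + (1 - 2n) a_{n-1}^2 + b_n^2`, where `n ≥ 1`. -/
def bdot (x : Space N) (n : ℕ) : ℝ :=
  (2 * (n : ℝ) + 3) * a x n ^ 2 + (1 - 2 * (n : ℝ)) * a x (n - 1) ^ 2 + b x n ^ 2

/-- The master symmetry `X_1 = ∑ ȧ_n ∂/∂a_n + ∑ ḃ_n ∂/∂b_n`, with `ȧ_n`, `ḃ_n` as above. -/
def X1 (N : ℕ) : VField N := fun x k =>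
  match k with
  | .inl i => adot x (i + 1)
  | .inr i => bdot x (i + 1)

/-- `X` is a smooth vector field given by an equation `L̇ = [B, L] + L^3` for some matrix `B`
depending on the point. As the entries of `L` are coordinates or zero, the derivative `L̇` of `L`
along `X` at `x` is `L (X x)`. -/
structure IsX2 (X : VField N) : Prop where
  smooth : ContDiff ℝ ∞ X
  lax : ∃ B : Space N → Matrix (Fin N) (Fin N) ℝ,
    ∀ x, L (X x) = (B x * L x - L x * B x) + L x ^ 3

/-- The sequence of master symmetries determined by `X_2`: `X_0` is the Euler vector field, `X_1`
and `X_2` are as above, and `[X_1, X_{n-1}] = (n - 2) X_n` for `n ≥ 3`. -/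
def masterSymm (X2 : VField N) : ℕ → VField N
  | 0 => fun x => x
  | 1 => X1 N
  | 2 => X2
  | n + 3 => fun x =>
      (1 / ((n : ℝ) + 1)) • VectorField.lieBracket ℝ (X1 N) (masterSymm X2 (n + 2)) x

/-- The Lie derivative of a contravariant 2-tensor:
`(L_X P)^{ij} = X(P^{ij}) - ∑_k P^{kj} ∂_k X^i - ∑_k P^{ik} ∂_k X^j`. -/
def lieDeriv (X : VField N) (P : Tensor N) : Tensor N := fun x i j =>
  fderiv ℝ (fun y => P y i j) x (X x)
    - ∑ k, P x k j * grad (fun y => X y i) x k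
    - ∑ k, P x i k * grad (fun y => X y j) x k

/-- A tensor is trivial if every `H_l`, `l ≥ 1`, is a Casimir of it. -/
def IsTrivial (P : Tensor N) : Prop :=
  ∀ l : ℕ, 1 ≤ l → ∀ x, (P x).mulVec (grad (H N l) x) = 0

/-- `IsPi X2 n P`: `P` is an `n`-th tensor `π_n` of the Toda hierarchy which the master symmetries
determined by `X2` generate from the linear, the quadratic and the cubic bracket. The generating
rule is `L_{X_k} π_m = (m - k - 2) π_{m+k}`, up to a trivial tensor, for those `m`, `k` for which it
determines `π_{m+k}` up to a trivial tensor. -/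
inductive IsPi (X2 : VField N) : ℕ → Tensor N → Prop
  | linear : IsPi X2 1 (linear N)
  | quadratic : IsPi X2 2 (quadratic N)
  | cubic : IsPi X2 3 (cubic N)
  | deform (m k : ℕ) (P Q : Tensor N) (hP : IsPi X2 m P) (hk : 1 ≤ k) (hmk : m ≠ k + 2)
      (smooth : ∀ i j, ContDiff ℝ ∞ (fun x => Q x i j))
      (antisymm : ∀ x i j, Q x j i = -Q x i j)
      (equiv : IsTrivial (fun x =>
        lieDeriv (masterSymm X2 k) P x - ((m : ℝ) - (k : ℝ) - 2) • Q x)) :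
      IsPi X2 (m + k) Q

theorem contDiff_a (n : ℕ) : ContDiff ℝ ∞ (fun x : Space N => a x n) := by
  unfold a; split <;> fun_prop

theorem contDiff_b (n : ℕ) : ContDiff ℝ ∞ (fun x : Space N => b x n) := by
  unfold b; split <;> fun_prop

theorem contDiff_L (i j : Fin N) : ContDiff ℝ ∞ (fun x : Space N => L x i j) := by
  unfold L
  split_ifs
  exacts [contDiff_b _, contDiff_a _, contDiff_a _, contDiff_const]

theorem contDiff_mul {A B : Space N → Matrix (Fin N) (Fin N) ℝ}
    (hA : ∀ i j, ContDiff ℝ ∞ (fun x => A x i j)) (hB : ∀ i j, ContDiff ℝ ∞ (fun x => B x i j))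
    (i j : Fin N) : ContDiff ℝ ∞ (fun x => (A x * B x) i j) := by
  simp only [Matrix.mul_apply]
  exact ContDiff.sum fun k _ => (hA i k).mul (hB k j)

theorem L_symm (x : Space N) (i j : Fin N) : L x j i = L x i j := by
  unfold L
  by_cases h : i = j
  · subst h; rfl
  · have h' : j ≠ i := fun e => h e.symm
    simp only [h, h', if_false]
    split_ifs <;> first | rfl | omega

theorem L_far (x : Space N) (i j : Fin N) (h : (i : ℕ) + 1 < j) : L x i j = 0 := by
  unfold L
  have h1 : i ≠ j := by rintro rfl; omega
  rw [if_neg h1, if_neg (by omega), if_neg (by omega)]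

/-- An explicit matrix `B` for `X_2`: antisymmetric, with entries
`i (L^2)_{ij} + (b_0 + … + b_{i-1}) L_{ij}` for `i < j`, indices being 0-based here. -/
def B2up (x : Space N) (i j : Fin N) : ℝ :=
  (i : ℝ) * (L x * L x) i j + (∑ l : Fin N, if l < i then L x l l else 0) * L x i j

/-- See `B2up`. -/
def B2 (x : Space N) : Matrix (Fin N) (Fin N) ℝ := fun i j =>
  if i < j then B2up x i j else if j < i then -B2up x j i else 0

/-- The right-hand side `[B, L] + L^3`. -/
def M2 (x : Space N) : Matrix (Fin N) (Fin N) ℝ :=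
  (B2 x * L x - L x * B2 x) + L x ^ 3

theorem M2_symm (x : Space N) : (M2 x).transpose = M2 x := by
  have hL : (L x).transpose = L x := by ext i j; exact L_symm x i j
  have hB : (B2 x).transpose = -B2 x := by
    ext i j
    simp only [Matrix.transpose_apply, Matrix.neg_apply, B2]
    rcases lt_trichotomy i j with h | h | h
    · simp [h, h.not_gt]
    · subst h; simp
    · simp [h, h.not_gt]
  simp only [M2, Matrix.transpose_add, Matrix.transpose_sub, Matrix.transpose_mul,
    Matrix.transpose_pow, hL, hB]
  noncomm_ring

theorem M2_far (x : Space N) (i j : Fin N) (h : (i : ℕ) + 1 < j) : M2 x i j = 0 := by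
  have e : M2 x i j = ∑ k : Fin N, (B2 x i k * L x k j - L x i k * B2 x k j
      + L x i k * (L x * L x) k j) := by
    simp only [M2, pow_three, Matrix.add_apply, Matrix.sub_apply, Matrix.mul_apply,
      Finset.sum_add_distrib, Finset.sum_sub_distrib]
  have e3 : ∑ k : Fin N, ((L x * L x) i k * L x k j) = ∑ k : Fin N, (L x i k * (L x * L x) k j) := by
    rw [← Matrix.mul_apply, ← Matrix.mul_apply, mul_assoc]
  set s : Fin N → ℝ := fun i => ∑ l : Fin N, if l < i then L x l l else 0 with hs
  have e4 : M2 x i j = ∑ k : Fin N, (L x i k * (((i : ℝ) + 1 - k) * (L x * L x) k j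
      + (s i - s k) * L x k j)) := by
    have : ∀ k : Fin N, B2 x i k * L x k j - L x i k * B2 x k j + L x i k * (L x * L x) k j
        = (i : ℝ) * ((L x * L x) i k * L x k j) - (i : ℝ) * (L x i k * (L x * L x) k j)
          + L x i k * (((i : ℝ) + 1 - k) * (L x * L x) k j + (s i - s k) * L x k j) := by
      intro k
      have h1 : B2 x i k * L x k j
          = ((i : ℝ) * (L x * L x) i k + s i * L x i k) * L x k j := by
        by_cases hk : i < k
        · simp [B2, B2up, hk, hs]
        · rw [L_far x k j (by rw [not_lt, Fin.le_def] at hk; omega)]; simp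
      have h2 : L x i k * B2 x k j
          = L x i k * ((k : ℝ) * (L x * L x) k j + s k * L x k j) := by
        by_cases hk : k < j
        · simp [B2, B2up, hk, hs]
        · rw [L_far x i k (by rw [not_lt, Fin.le_def] at hk; omega)]; simp
      rw [h1, h2]; ring
    rw [e, Finset.sum_congr rfl fun k _ => this k, Finset.sum_add_distrib, Finset.sum_sub_distrib,
      ← Finset.mul_sum, ← Finset.mul_sum, e3]
    ring
  have sq_far : ∀ k l : Fin N, (k : ℕ) + 2 < l → (L x * L x) k l = 0 := by
    intro k l hkl
    rw [Matrix.mul_apply]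
    refine Finset.sum_eq_zero fun m _ => ?_
    by_cases hm : (k : ℕ) + 1 < m
    · rw [L_far x k m hm, zero_mul]
    · rw [L_far x m l (by omega), mul_zero]
  obtain ⟨k1, hk1⟩ : ∃ k1 : Fin N, (k1 : ℕ) = i + 1 := ⟨⟨i + 1, by omega⟩, rfl⟩
  have hik : i ≠ k1 := by rintro rfl; omega
  rw [e4, Finset.sum_eq_add i k1 hik]
  · have hsk : s k1 - s i = L x i i := by
      rw [hs]
      simp only
      rw [← Finset.sum_sub_distrib, Finset.sum_eq_single i]
      · have : i < k1 := by rw [Fin.lt_def]; omega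
        simp [this]
      · intro l _ hl
        have hl' : (l : ℕ) ≠ i := fun e => hl (Fin.ext e)
        by_cases h1 : l < i
        · have h2 : l < k1 := by rw [Fin.lt_def] at *; omega
          simp [h1, h2]
        · have h2 : ¬ l < k1 := by rw [Fin.lt_def] at *; omega
          simp [h1, h2]
      · simp
    have hsq : (L x * L x) i j = L x i k1 * L x k1 j := by
      rw [Matrix.mul_apply, Finset.sum_eq_single k1]
      · intro m _ hm
        have hm' : (m : ℕ) ≠ k1 := fun e => hm (Fin.ext e)
        by_cases hm2 : (i : ℕ) + 1 < m
        · rw [L_far x i m hm2, zero_mul]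
        · rw [L_far x m j (by omega), mul_zero]
      · simp
    have hc : ((k1 : ℕ) : ℝ) = (i : ℝ) + 1 := by rw [hk1]; push_cast; ring
    have hs' : s i - s k1 = -L x i i := by linarith
    rw [hsq, hc, hs', sub_self (s i), L_far x i j h]
    ring
  · intro k _ hk
    have h1 : (k : ℕ) ≠ i := fun e => hk.1 (Fin.ext e)
    have h2 : (k : ℕ) ≠ i + 1 := fun e => hk.2 (Fin.ext (e.trans hk1.symm))
    by_cases h3 : (i : ℕ) + 1 < k
    · rw [L_far x i k h3, zero_mul]
    · rw [sq_far k j (by omega), L_far x k j (by omega)]; ring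
  · simp
  · simp

/-- There is a vector field `X_2` as required. -/
theorem exists_isX2 (N : ℕ) : ∃ X : VField N, IsX2 X := by
  refine ⟨fun x k => match k with
    | .inl i => M2 x ⟨i, by omega⟩ ⟨i + 1, by omega⟩
    | .inr i => M2 x i i, ?_, B2, fun x => ?_⟩
  · have hup : ∀ i j : Fin N, ContDiff ℝ ∞ (fun x => B2up x i j) := fun i j => by
      unfold B2up
      refine (contDiff_const.mul (contDiff_mul contDiff_L contDiff_L i j)).add
        (ContDiff.mul (ContDiff.sum fun l _ => ?_) (contDiff_L i j))
      split_ifs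
      exacts [contDiff_L _ _, contDiff_const]
    have hB : ∀ i j : Fin N, ContDiff ℝ ∞ (fun x => B2 x i j) := fun i j => by
      unfold B2
      split_ifs
      exacts [hup i j, (hup j i).neg, contDiff_const]
    have hM : ∀ i j : Fin N, ContDiff ℝ ∞ (fun x => M2 x i j) := fun i j => by
      simp only [M2, pow_three, Matrix.add_apply, Matrix.sub_apply]
      exact ((contDiff_mul hB contDiff_L i j).sub (contDiff_mul contDiff_L hB i j)).add
        (contDiff_mul contDiff_L (contDiff_mul contDiff_L contDiff_L) i j)
    rw [contDiff_pi]
    rintro (i | i)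
    exacts [hM _ _, hM _ _]
  · change _ = M2 x
    have hsym : ∀ i j, M2 x j i = M2 x i j := fun i j => congrFun (congrFun (M2_symm x) i) j
    ext i j
    unfold L
    by_cases h1 : i = j
    · subst h1; simp [b, Nat.succ_le_of_lt i.isLt]
    · have h1' : (i : ℕ) ≠ j := fun e => h1 (Fin.ext e)
      rw [if_neg h1]
      by_cases h2 : (i : ℕ) + 1 = j
      · rw [if_pos h2, a, dif_pos ⟨by omega, by omega⟩]
        exact congrArg₂ (M2 x) (Fin.ext (by simp)) (Fin.ext (by simp; omega))
      · rw [if_neg h2]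
        by_cases h3 : (j : ℕ) + 1 = i
        · rw [if_pos h3, a, dif_pos ⟨by omega, by omega⟩]
          rw [← hsym]
          exact congrArg₂ (M2 x) (Fin.ext (by simp)) (Fin.ext (by simp; omega))
        · rw [if_neg h3]
          rcases Nat.lt_or_ge i j with h | h
          · exact (M2_far x i j (by omega)).symm
          · rw [← hsym]; exact (M2_far x j i (by omega)).symm

theorem contDiff_X1 (N : ℕ) : ContDiff ℝ ∞ (X1 N) := by
  rw [contDiff_pi]
  rintro (i | i)
  · have h1 := contDiff_a (N := N) (i + 1)
    have h2 := contDiff_b (N := N) (i + 1)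
    have h3 := contDiff_b (N := N) (i + 1 + 1)
    simp only [X1, adot]
    fun_prop
  · have h1 := contDiff_a (N := N) (i + 1)
    have h2 := contDiff_a (N := N) (i + 1 - 1)
    have h3 := contDiff_b (N := N) (i + 1)
    simp only [X1, bdot]
    fun_prop

theorem skew_antisymm (aa ab bb : ℕ → ℕ → ℝ) (i j : Idx N) :
    skew aa ab bb j i = -skew aa ab bb i j := by
  rcases i with i | i <;> rcases j with j | j <;> simp only [skew, neg_neg]
  all_goals
    rcases lt_trichotomy i j with h | h | h
    · simp [h, h.not_gt]
    · subst h; simp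
    · simp [h, h.not_gt]

theorem contDiff_quadratic (i j : Idx N) : ContDiff ℝ ∞ (fun x => quadratic N x i j) := by
  have ha := contDiff_a (N := N)
  have hb := contDiff_b (N := N)
  rcases i with i | i <;> rcases j with j | j <;> simp only [quadratic, skew] <;> split_ifs <;>
    fun_prop

/-- The generating rule with equality instead of equality up to a trivial tensor. -/
theorem IsPi.step {X2 : VField N} {m k : ℕ} {P : Tensor N} (hP : IsPi X2 m P) (hk : 1 ≤ k)
    (hmk : m ≠ k + 2) (hX : ContDiff ℝ ∞ (masterSymm X2 k))
    (smooth : ∀ i j, ContDiff ℝ ∞ (fun x => P x i j)) (antisymm : ∀ x i j, P x j i = -P x i j) :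
    ∃ Q, IsPi X2 (m + k) Q ∧ (∀ i j, ContDiff ℝ ∞ (fun x => Q x i j)) ∧
      ∀ x i j, Q x j i = -Q x i j := by
  have hX' : ∀ i, ContDiff ℝ ∞ (fun x => masterSymm X2 k x i) := contDiff_pi.1 hX
  have hg : ∀ i l, ContDiff ℝ ∞ (fun x => grad (fun y => masterSymm X2 k y i) x l) := fun i l => by
    unfold grad
    exact ((hX' i).fderiv_right (m := ∞) (by simp)).clm_apply contDiff_const
  have hs : ∀ i j, ContDiff ℝ ∞
      (fun x => (((m : ℝ) - k - 2)⁻¹ • lieDeriv (masterSymm X2 k) P x) i j) := fun i j => by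
    simp only [Matrix.smul_apply, lieDeriv, smul_eq_mul]
    refine contDiff_const.mul (ContDiff.sub (ContDiff.sub ?_ ?_) ?_)
    · exact ((smooth i j).fderiv_right (m := ∞) (by simp)).clm_apply hX
    · exact ContDiff.sum fun l _ => (smooth l j).mul (hg i l)
    · exact ContDiff.sum fun l _ => (smooth i l).mul (hg j l)
  have hsk : ∀ x i j, (((m : ℝ) - k - 2)⁻¹ • lieDeriv (masterSymm X2 k) P x) j i
      = -(((m : ℝ) - k - 2)⁻¹ • lieDeriv (masterSymm X2 k) P x) i j := fun x i j => by
    have h1 : (fun y => P y j i) = -(fun y => P y i j) := by ext y; simp [antisymm y i j]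
    simp only [Matrix.smul_apply, lieDeriv, smul_eq_mul]
    rw [h1, fderiv_neg]
    simp only [antisymm x i, antisymm x _ j, neg_apply, neg_mul,
      Finset.sum_neg_distrib]
    ring
  have hc : (m : ℝ) - k - 2 ≠ 0 := by
    intro h
    apply hmk
    have : (m : ℝ) = k + 2 := by linarith
    exact_mod_cast this
  refine ⟨_, IsPi.deform m k P _ hP hk hmk hs hsk fun l _ x => ?_, hs, hsk⟩
  simp [hc]

/-- The hierarchy has a tensor `π_n` for every `n ≥ 1`. -/
theorem exists_isPi {X2 : VField N} (hX2 : IsX2 X2) (n : ℕ) (hn : 1 ≤ n) :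
    ∃ P, IsPi X2 n P := by
  have key : ∀ r : ℕ, ∃ Q, IsPi X2 (4 + r) Q ∧ (∀ i j, ContDiff ℝ ∞ (fun x => Q x i j)) ∧
      ∀ x i j, Q x j i = -Q x i j := by
    intro r
    induction r with
    | zero =>
      exact IsPi.quadratic.step (k := 2) (by omega) (by omega) hX2.smooth
        contDiff_quadratic (fun _ => skew_antisymm _ _ _)
    | succ r ih =>
      obtain ⟨Q, h, hs, hsk⟩ := ih
      exact h.step (k := 1) le_rfl (by omega) (contDiff_X1 N) hs hsk
  by_cases h : 4 ≤ n
  · obtain ⟨Q, hQ, -⟩ := key (n - 4)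
    rw [Nat.add_sub_cancel' h] at hQ
    exact ⟨Q, hQ⟩
  · obtain rfl | rfl | rfl : n = 1 ∨ n = 2 ∨ n = 3 := by omega
    exacts [⟨_, .linear⟩, ⟨_, .quadratic⟩, ⟨_, .cubic⟩]

end Toda

end

open scoped ContDiff

noncomputable section

namespace Toda

variable {N : ℕ}

/-! Involution is proved for the three explicit brackets and then carried through the deformation
rule. For the explicit brackets, the Lenard relations `π₁ dH_{l+1} = π₂ dH_l` and `π₂ dH_{l+1} = π₃
dH_l` hold (`linear_quadratic_recursion`, `quadratic_cubic_recursion`), and Magri's argument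
`involutive_of_recursion` applies. The gradient of `H_{l+1}` consists of the entries `(L^l)_{nn}`
and `2 (L^l)_{n,n+1}`, so each relation becomes an identity between entries of `L^l` and `L^{l+1}`.
It follows from the three-term recurrences for multiplication by a tridiagonal matrix. For the
deformation, the key fact is `X_k(H_l) = (l + k) H_{l+k}` for `k ≥ 1` (`along_masterSymm`). By the
Leibniz rule `bracket_lieDeriv`, the bracket of `L_{X_k} π_m` on `H_i, H_j` is `X_k{H_i, H_j} - {X_k
H_i, H_j} - {H_i, X_k H_j}`, and all three terms vanish if the `H`s are in involution for `π_m`. A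
trivial tensor does not change brackets of the `H`s, and `m - k - 2 ≠ 0` can be divided out. -/

/-! ### Entries of products with the Jacobi matrix. -/

/-- The entries of a matrix with 1-based indices, extended by zero. -/
def entry (M : Matrix (Fin N) (Fin N) ℝ) (i j : ℕ) : ℝ :=
  if h : (1 ≤ i ∧ i ≤ N) ∧ (1 ≤ j ∧ j ≤ N) then M ⟨i - 1, by omega⟩ ⟨j - 1, by omega⟩ else 0

theorem entry_succ (M : Matrix (Fin N) (Fin N) ℝ) (i j : Fin N) :
    entry M (i + 1) (j + 1) = M i j := by
  rw [entry, dif_pos ⟨⟨by omega, by omega⟩, by omega, by omega⟩]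
  rfl

theorem entry_eq_zero (M : Matrix (Fin N) (Fin N) ℝ) {i j : ℕ}
    (h : i = 0 ∨ N < i ∨ j = 0 ∨ N < j) : entry M i j = 0 := by
  rw [entry, dif_neg (by omega)]

theorem entry_comm {M : Matrix (Fin N) (Fin N) ℝ} (hM : M.transpose = M) (i j : ℕ) :
    entry M i j = entry M j i := by
  unfold entry
  by_cases h : (1 ≤ i ∧ i ≤ N) ∧ (1 ≤ j ∧ j ≤ N)
  · rw [dif_pos h, dif_pos h.symm]
    exact congrFun (congrFun hM.symm _) _
  · rw [dif_neg h, dif_neg (fun h' => h h'.symm)]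

theorem a_zero (x : Space N) : a x 0 = 0 := by simp [a]

theorem a_of_le (x : Space N) {n : ℕ} (h : N ≤ n) : a x n = 0 := by
  rw [a, dif_neg (by omega)]

theorem b_of_lt (x : Space N) {n : ℕ} (h : N < n) : b x n = 0 := by
  rw [b, dif_neg (by omega)]

theorem a_succ (x : Space N) (i : Fin (N - 1)) : a x (i + 1) = x (.inl i) := by
  rw [a, dif_pos (by omega)]; rfl

theorem b_succ (x : Space N) (i : Fin N) : b x (i + 1) = x (.inr i) := by
  rw [b, dif_pos (by omega)]; rfl

/-- A sum over 1-based indices with at most one nonzero term. -/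
theorem sum_ite_succ_eq (K : ℕ) (g : ℕ → ℝ) (c : ℕ) (h : c = 0 ∨ K < c → g c = 0) :
    ∑ j : Fin K, (if (j : ℕ) + 1 = c then g (j + 1) else 0) = g c := by
  by_cases hc : c = 0 ∨ K < c
  · rw [h hc]
    exact Finset.sum_eq_zero fun j _ => if_neg (by omega)
  · obtain ⟨c, rfl⟩ : ∃ d, c = d + 1 := ⟨c - 1, by omega⟩
    rw [Finset.sum_eq_single ⟨c, by omega⟩]
    · simp
    · intro j _ hj
      exact if_neg fun e => hj (Fin.ext (by simpa using e))
    · simp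

/-- Each diagonal is a condition on the 1-based column `j + 1` with a coefficient depending on `j`,
so that a sum over `j` collapses by `sum_ite_succ_eq`. -/
theorem L_apply (x : Space N) (i j : Fin N) :
    L x i j = (if (j : ℕ) + 1 = i then a x (j + 1) else 0)
      + (if (j : ℕ) + 1 = i + 1 then b x (j + 1) else 0)
      + (if (j : ℕ) + 1 = i + 2 then a x j else 0) := by
  unfold L
  by_cases h : i = j
  · subst h; simp
  · have h' : (i : ℕ) ≠ j := fun e => h (Fin.ext e)
    rw [if_neg h]
    by_cases h1 : (i : ℕ) + 1 = j
    · rw [if_pos h1, if_neg (by omega), if_neg (by omega), if_pos (by omega), h1]; ring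
    · rw [if_neg h1, if_neg (show ¬ ((j : ℕ) + 1 = i + 1) by omega),
        if_neg (show ¬ ((j : ℕ) + 1 = i + 2) by omega)]
      ring

/-- Extending `a`, `b` and the entries by zero makes one recurrence valid in every row, the first
and the last included. -/
theorem entry_L_mul (x : Space N) (M : Matrix (Fin N) (Fin N) ℝ) (i j : ℕ) :
    entry (L x * M) (i + 1) j
      = a x i * entry M i j + b x (i + 1) * entry M (i + 1) j
        + a x (i + 1) * entry M (i + 2) j := by
  by_cases hj : j = 0 ∨ N < j
  · simp [entry_eq_zero _ (Or.inr (Or.inr hj))]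
  by_cases hi : N < i + 1
  · rw [entry_eq_zero _ (by omega), a_of_le x (n := i) (by omega), b_of_lt x hi,
      a_of_le x (n := i + 1) (by omega)]
    ring
  obtain ⟨j, rfl⟩ : ∃ d, j = d + 1 := ⟨j - 1, by omega⟩
  have e := entry_succ (L x * M) ⟨i, by omega⟩ ⟨j, by omega⟩
  simp only at e
  rw [e, Matrix.mul_apply]
  have e1 : ∀ k : Fin N, L x ⟨i, by omega⟩ k * M k ⟨j, by omega⟩
      = (if (k : ℕ) + 1 = i then (fun n => a x n * entry M n (j + 1)) (k + 1) else 0)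
      + (if (k : ℕ) + 1 = i + 1 then (fun n => b x n * entry M n (j + 1)) (k + 1) else 0)
      + (if (k : ℕ) + 1 = i + 2 then (fun n => a x (n - 1) * entry M n (j + 1)) (k + 1) else 0) := by
    intro k
    rw [L_apply, ← entry_succ M k ⟨j, by omega⟩]
    simp only [add_mul, ite_mul, zero_mul, Nat.add_sub_cancel]
  rw [Finset.sum_congr rfl fun k _ => e1 k, Finset.sum_add_distrib, Finset.sum_add_distrib]
  refine congrArg₂ (· + ·) (congrArg₂ (· + ·) (sum_ite_succ_eq N (fun n => a x n * entry M n (j + 1)) i ?_)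
    (sum_ite_succ_eq N (fun n => b x n * entry M n (j + 1)) (i + 1) ?_))
    (sum_ite_succ_eq N (fun n => a x (n - 1) * entry M n (j + 1)) (i + 2) ?_)
  all_goals
    intro h
    rw [entry_eq_zero _ (by omega), mul_zero]

theorem L_transpose (x : Space N) : (L x).transpose = L x := by
  ext i j; exact L_symm x i j

theorem L_pow_transpose (x : Space N) (n : ℕ) : (L x ^ n).transpose = L x ^ n := by
  rw [Matrix.transpose_pow, L_transpose]

/-- Here `L * M` is symmetric, so this is the transposed row recurrence. Equating it with
`entry_L_mul` expresses that `L` and `M` commute. -/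
theorem entry_mul_L (x : Space N) {M : Matrix (Fin N) (Fin N) ℝ} (hM : M.transpose = M)
    (hc : L x * M = M * L x) (i j : ℕ) :
    entry (L x * M) i (j + 1)
      = a x j * entry M i j + b x (j + 1) * entry M i (j + 1)
        + a x (j + 1) * entry M i (j + 2) := by
  have h : (L x * M).transpose = L x * M := by
    rw [Matrix.transpose_mul, hM, L_transpose, hc]
  rw [entry_comm h, entry_L_mul, entry_comm hM j, entry_comm hM (j + 1), entry_comm hM (j + 2)]

theorem trace_eq_sum_entry (M : Matrix (Fin N) (Fin N) ℝ) :
    M.trace = ∑ n ∈ Finset.range N, entry M (n + 1) (n + 1) := by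
  rw [← Fin.sum_univ_eq_sum_range (fun n => entry M (n + 1) (n + 1)) N]
  simp only [entry_succ]
  rfl

/-- The two off-diagonals contribute equally: their difference is the telescoping sum of `a v n *
entry M n (n + 1)`, which vanishes at `0` and `N`. -/
theorem trace_L_mul (v : Space N) {M : Matrix (Fin N) (Fin N) ℝ} (hM : M.transpose = M) :
    (L v * M).trace = ∑ n ∈ Finset.range N,
      (b v (n + 1) * entry M (n + 1) (n + 1) + 2 * a v (n + 1) * entry M (n + 1) (n + 2)) := by
  have key := Finset.sum_range_sub (fun n => a v n * entry M n (n + 1)) N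
  rw [a_of_le v le_rfl, a_zero] at key
  rw [trace_eq_sum_entry, ← sub_eq_zero, ← Finset.sum_sub_distrib,
    ← neg_eq_zero, ← Finset.sum_neg_distrib]
  rw [zero_mul, zero_mul, sub_zero] at key
  rw [← key]
  refine Finset.sum_congr rfl fun n _ => ?_
  rw [entry_L_mul, entry_comm hM (n + 2)]
  ring

/-! ### Derivatives and gradients of the integrals. -/

/-- The derivative of `L ^ n` in the direction in which `L` has the derivative `V`. -/
def powDeriv (A V : Matrix (Fin N) (Fin N) ℝ) : ℕ → Matrix (Fin N) (Fin N) ℝ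
  | 0 => 0
  | n + 1 => powDeriv A V n * A + A ^ n * V

/-- Cyclicity of the trace. The spare factor `A ^ k` is what lets the induction absorb the `A` split
off by `powDeriv`. -/
theorem trace_powDeriv_mul_pow (A V : Matrix (Fin N) (Fin N) ℝ) (n k : ℕ) :
    (powDeriv A V (n + 1) * A ^ k).trace = ((n : ℝ) + 1) * (V * A ^ (n + k)).trace := by
  have h : ∀ n k, (A ^ n * V * A ^ k).trace = (V * A ^ (n + k)).trace := fun n k => by
    rw [mul_assoc, Matrix.trace_mul_comm, mul_assoc, ← pow_add, add_comm]
  induction n generalizing k with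
  | zero => simp [powDeriv]
  | succ n ih =>
    rw [powDeriv, add_mul, Matrix.trace_add, h, mul_assoc, ← pow_succ', ih,
      show n + (k + 1) = n + 1 + k by ring]
    push_cast
    ring

theorem a_line (x v : Space N) (t : ℝ) (n : ℕ) : a (x + t • v) n = a x n + t * a v n := by
  unfold a; split <;> simp

theorem b_line (x v : Space N) (t : ℝ) (n : ℕ) : b (x + t • v) n = b x n + t * b v n := by
  unfold b; split <;> simp

theorem L_line (x v : Space N) (t : ℝ) (i j : Fin N) :
    L (x + t • v) i j = L x i j + t * L v i j := by
  unfold L; split_ifs <;> simp [a_line, b_line]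

theorem hasDerivAt_L_pow (x v : Space N) (n : ℕ) (i j : Fin N) :
    HasDerivAt (fun t : ℝ => (L (x + t • v) ^ n) i j) (powDeriv (L x) (L v) n i j) 0 := by
  induction n generalizing i j with
  | zero => simpa [powDeriv] using hasDerivAt_const (0 : ℝ) ((1 : Matrix (Fin N) (Fin N) ℝ) i j)
  | succ n ih =>
    have hL : ∀ k, HasDerivAt (fun t : ℝ => L (x + t • v) k j) (L v k j) 0 := fun k => by
      simp only [L_line]
      simpa using ((hasDerivAt_id (0 : ℝ)).mul_const (L v k j)).const_add (L x k j)
    simp only [pow_succ, Matrix.mul_apply, powDeriv, Matrix.add_apply]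
    rw [← Finset.sum_add_distrib]
    refine HasDerivAt.fun_sum fun k _ => ?_
    simpa using (ih i k).fun_mul (hL k)

theorem contDiff_L_pow (n : ℕ) (i j : Fin N) : ContDiff ℝ ∞ (fun x : Space N => (L x ^ n) i j) := by
  induction n generalizing i j with
  | zero => simpa using contDiff_const
  | succ n ih =>
    simp only [pow_succ]
    exact contDiff_mul ih contDiff_L i j

theorem contDiff_H (l : ℕ) : ContDiff ℝ ∞ (H N l) := by
  unfold H Matrix.trace
  exact contDiff_const.mul (ContDiff.sum fun i _ => contDiff_L_pow l i i)

/-- Both sides are the derivative of `H` along the line `x + t • v` at `t = 0`; the `l + 1` equal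
traces cancel the normalisation of `H`. -/
theorem fderiv_H (l : ℕ) (x v : Space N) :
    fderiv ℝ (H N (l + 1)) x v = (L v * L x ^ l).trace := by
  have h1 : HasDerivAt (fun t : ℝ => H N (l + 1) (x + t • v)) (fderiv ℝ (H N (l + 1)) x v) 0 := by
    have hd : HasFDerivAt (H N (l + 1)) (fderiv ℝ (H N (l + 1)) x) (x + (0 : ℝ) • v) := by
      simpa using ((contDiff_H (l + 1)).differentiable (by simp) x).hasFDerivAt
    have hl : HasDerivAt (fun t : ℝ => x + t • v) v 0 := by
      simpa using ((hasDerivAt_id (0 : ℝ)).smul_const v).const_add x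
    exact hd.comp_hasDerivAt 0 hl
  have h2 : HasDerivAt (fun t : ℝ => H N (l + 1) (x + t • v))
      (1 / ((l + 1 : ℕ) : ℝ) * (powDeriv (L x) (L v) (l + 1)).trace) 0 := by
    unfold H Matrix.trace
    exact (HasDerivAt.fun_sum fun i _ => hasDerivAt_L_pow x v (l + 1) i i).const_mul _
  rw [h1.unique h2]
  have := trace_powDeriv_mul_pow (L x) (L v) l 0
  rw [pow_zero, mul_one, add_zero] at this
  rw [this]
  have : (l : ℝ) + 1 ≠ 0 := by positivity
  push_cast
  field_simp

/-- The factor `2` arises because each `a` occupies two entries of `L`. -/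
theorem grad_H_inl (l : ℕ) (x : Space N) (i : Fin (N - 1)) :
    grad (H N (l + 1)) x (.inl i) = 2 * entry (L x ^ l) (i + 1) (i + 2) := by
  rw [grad, fderiv_H, trace_L_mul _ (L_pow_transpose x l), Finset.sum_eq_single (i : ℕ)]
  · have hi : (i : ℕ) < N := by omega
    have := b_succ (Pi.single (.inl i) 1 : Space N) ⟨i, hi⟩
    simp only at this
    rw [a_succ, this]
    simp
  · intro n hn hni
    rw [Finset.mem_range] at hn
    have := b_succ (Pi.single (.inl i) 1 : Space N) ⟨n, hn⟩
    simp only at this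
    rw [this]
    by_cases h : n < N - 1
    · have := a_succ (Pi.single (.inl i) 1 : Space N) ⟨n, h⟩
      simp only at this
      rw [this]
      simp [Fin.ext_iff, hni]
    · rw [a_of_le _ (by omega)]; simp
  · intro h; simp at h; omega

theorem grad_H_inr (l : ℕ) (x : Space N) (i : Fin N) :
    grad (H N (l + 1)) x (.inr i) = entry (L x ^ l) (i + 1) (i + 1) := by
  rw [grad, fderiv_H, trace_L_mul _ (L_pow_transpose x l), Finset.sum_eq_single (i : ℕ)]
  · rw [b_succ]
    by_cases h : (i : ℕ) < N - 1
    · have := a_succ (Pi.single (.inr i) 1 : Space N) ⟨i, h⟩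
      simp only at this
      rw [this]
      simp
    · rw [a_of_le _ (by omega)]; simp
  · intro n hn hni
    rw [Finset.mem_range] at hn
    have := b_succ (Pi.single (.inr i) 1 : Space N) ⟨n, hn⟩
    simp only at this
    rw [this]
    by_cases h : n < N - 1
    · have := a_succ (Pi.single (.inr i) 1 : Space N) ⟨n, h⟩
      simp only at this
      rw [this]
      simp [Fin.ext_iff, hni]
    · rw [a_of_le _ (by omega)]; simp [Fin.ext_iff, hni]
  · intro h; simp at h

/-! ### Vector fields, Lie derivatives and brackets. -/

theorem fderiv_eq_sum_grad (f : Space N → ℝ) (x v : Space N) :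
    fderiv ℝ f x v = ∑ i, v i * grad f x i := by
  conv_lhs => rw [pi_eq_sum_univ' v, map_sum]
  simp only [map_smul, smul_eq_mul]
  rfl

theorem differentiable_grad {f : Space N → ℝ} (hf : ContDiff ℝ ∞ f) (i : Idx N) :
    Differentiable ℝ (fun x => grad f x i) := by
  unfold grad
  exact ((hf.fderiv_right (m := ∞) (by simp)).clm_apply contDiff_const).differentiable (by simp)

theorem grad_grad_comm {f : Space N → ℝ} (hf : ContDiff ℝ ∞ f) (x : Space N) (i j : Idx N) :
    grad (fun y => grad f y i) x j = grad (fun y => grad f y j) x i := by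
  have hd : DifferentiableAt ℝ (fderiv ℝ f) x :=
    (hf.fderiv_right (m := ∞) (by simp)).differentiable (by simp) x
  have h : ∀ i j, grad (fun y => grad f y i) x j
      = fderiv ℝ (fderiv ℝ f) x (Pi.single j 1) (Pi.single i 1) := fun i j => by
    unfold grad
    rw [fderiv_clm_apply hd (differentiableAt_const _)]
    simp
  rw [h, h]
  exact (hf.contDiffAt.isSymmSndFDerivAt
    (by rw [minSmoothness_of_isRCLikeNormedField]; exact WithTop.coe_le_coe.2 (le_top (a := (2 : ℕ∞))))).eq _ _

/-- The derivative of the function `f` along the vector field `X`. -/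
def along (X : VField N) (f : Space N → ℝ) (x : Space N) : ℝ := fderiv ℝ f x (X x)

/-- Symmetry of second derivatives turns `∑ X^k ∂_l ∂_k f` into the derivative of `∂_l f` along `X`.
-/
theorem grad_along {X : VField N} (hX : Differentiable ℝ X) {f : Space N → ℝ}
    (hf : ContDiff ℝ ∞ f) (x : Space N) (l : Idx N) :
    grad (along X f) x l = ∑ k, grad f x k * grad (fun y => X y k) x l
      + fderiv ℝ (fun y => grad f y l) x (X x) := by
  have hX' : ∀ k, DifferentiableAt ℝ (fun y => X y k) x := fun k =>
    differentiable_pi.1 hX k x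
  have hm : ∀ k, DifferentiableAt ℝ (fun y => X y k * grad f y k) x := fun k =>
    (hX' k).mul (differentiable_grad hf k x)
  have e : along X f = fun y => ∑ k, X y k * grad f y k := by
    funext y; exact fderiv_eq_sum_grad f y (X y)
  rw [e, grad, fderiv_fun_sum fun k _ => hm k,
    fderiv_eq_sum_grad (fun y => grad f y l), ← Finset.sum_add_distrib, sum_apply]
  refine Finset.sum_congr rfl fun k _ => ?_
  rw [fderiv_fun_mul (hX' k) (differentiable_grad hf k x), grad_grad_comm hf x l k]
  simp only [add_apply, smul_apply, smul_eq_mul]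
  unfold grad
  ring

/-- The Leibniz rule for the Lie derivative of a bracket. -/
theorem bracket_lieDeriv {X : VField N} (hX : Differentiable ℝ X) {P : Tensor N}
    (hP : ∀ i j, Differentiable ℝ (fun x => P x i j)) {f g : Space N → ℝ}
    (hf : ContDiff ℝ ∞ f) (hg : ContDiff ℝ ∞ g) (x : Space N) :
    bracket (lieDeriv X P) f g x = along X (bracket P f g) x
      - bracket P (along X f) g x - bracket P f (along X g) x := by
  have e : along X (bracket P f g) x = ∑ i, ∑ j,
      (fderiv ℝ (fun y => P y i j) x (X x) * grad f x i * grad g x j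
        + P x i j * fderiv ℝ (fun y => grad f y i) x (X x) * grad g x j
        + P x i j * grad f x i * fderiv ℝ (fun y => grad g y j) x (X x)) := by
    have h1 : ∀ i j, DifferentiableAt ℝ (fun y => P y i j * grad f y i) x := fun i j =>
      (hP i j x).mul (differentiable_grad hf i x)
    have h2 : ∀ i j, DifferentiableAt ℝ (fun y => P y i j * grad f y i * grad g y j) x :=
      fun i j => (h1 i j).mul (differentiable_grad hg j x)
    unfold along bracket
    rw [fderiv_fun_sum fun i _ => DifferentiableAt.fun_sum fun j _ => h2 i j,
      sum_apply]
    refine Finset.sum_congr rfl fun i _ => ?_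
    rw [fderiv_fun_sum fun j _ => h2 i j, sum_apply]
    refine Finset.sum_congr rfl fun j _ => ?_
    rw [fderiv_fun_mul (h1 i j) (differentiable_grad hg j x),
      fderiv_fun_mul (hP i j x) (differentiable_grad hf i x)]
    simp only [add_apply, smul_apply, smul_eq_mul]
    ring
  -- After renaming indices, the two correction terms of `lieDeriv` are the parts of `{X f, g}` and
  -- `{f, X g}` in which the coefficients of `X` are differentiated.
  have e1 : ∑ i, ∑ j, (∑ k, P x k j * grad (fun y => X y i) x k) * grad f x i * grad g x j
      = ∑ i, ∑ j, P x i j * (∑ k, grad f x k * grad (fun y => X y k) x i) * grad g x j := by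
    simp only [Finset.sum_mul, Finset.mul_sum]
    rw [Finset.sum_congr rfl fun i _ => Finset.sum_comm, Finset.sum_comm]
    refine Finset.sum_congr rfl fun k _ => ?_
    rw [Finset.sum_comm]
    refine Finset.sum_congr rfl fun j _ => Finset.sum_congr rfl fun i _ => ?_
    ring
  have e2 : ∑ i, ∑ j, (∑ k, P x i k * grad (fun y => X y j) x k) * grad f x i * grad g x j
      = ∑ i, ∑ j, P x i j * grad f x i * (∑ k, grad g x k * grad (fun y => X y k) x j) := by
    simp only [Finset.sum_mul, Finset.mul_sum]
    refine Finset.sum_congr rfl fun i _ => ?_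
    rw [Finset.sum_comm]
    refine Finset.sum_congr rfl fun k _ => Finset.sum_congr rfl fun j _ => ?_
    ring
  rw [e]
  simp only [bracket, lieDeriv, grad_along hX hf, grad_along hX hg, sub_mul, mul_add, add_mul,
    Finset.sum_sub_distrib, Finset.sum_add_distrib]
  rw [e1, e2]
  ring

/-- The second-order terms of the two compositions cancel by symmetry of the second derivative. -/
theorem along_lieBracket {X Y : VField N} (hX : Differentiable ℝ X) (hY : Differentiable ℝ Y)
    {f : Space N → ℝ} (hf : ContDiff ℝ ∞ f) (x : Space N) :
    fderiv ℝ f x (VectorField.lieBracket ℝ X Y x)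
      = along X (along Y f) x - along Y (along X f) x := by
  have hd : DifferentiableAt ℝ (fderiv ℝ f) x :=
    (hf.fderiv_right (m := ∞) (by simp)).differentiable (by simp) x
  have h : ∀ {X Y : VField N}, Differentiable ℝ Y → along X (along Y f) x
      = fderiv ℝ (fderiv ℝ f) x (X x) (Y x) + fderiv ℝ f x (fderiv ℝ Y x (X x)) := by
    intro X Y hY
    conv_lhs => unfold along
    rw [fderiv_clm_apply hd (hY x)]
    simp [add_comm]
  rw [h hX, h hY, VectorField.lieBracket, map_sub,
    (hf.contDiffAt.isSymmSndFDerivAt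
    (by rw [minSmoothness_of_isRCLikeNormedField]; exact WithTop.coe_le_coe.2 (le_top (a := (2 : ℕ∞))))).eq]
  ring

/-! ### Action of the master symmetries on the integrals. -/

theorem contDiff_masterSymm {X2 : VField N} (hX2 : IsX2 X2) (k : ℕ) :
    ContDiff ℝ ∞ (masterSymm X2 k) := by
  match k with
  | 0 => exact contDiff_id
  | 1 => exact contDiff_X1 N
  | 2 => exact hX2.smooth
  | n + 3 =>
    have h := contDiff_masterSymm hX2 (n + 2)
    have h1 := contDiff_X1 N
    unfold masterSymm VectorField.lieBracket
    exact ContDiff.smul (f := fun _ : Space N => 1 / ((n : ℝ) + 1)) contDiff_const (((h.fderiv_right (m := ∞) (by simp)).clm_apply h1).sub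
      ((h1.fderiv_right (m := ∞) (by simp)).clm_apply h))

theorem trace_L_pow (x : Space N) (n : ℕ) : (L x ^ (n + 1)).trace = ((n : ℝ) + 1) * H N (n + 1) x := by
  have : (n : ℝ) + 1 ≠ 0 := by positivity
  rw [H]
  push_cast
  field_simp

/-- The commutator drops out, since `Tr([B, L] L^l) = 0` by cyclicity; only `Tr L^{l+3}` remains,
whatever `B` is. -/
theorem along_X2 {X2 : VField N} (hX2 : IsX2 X2) (l : ℕ) (x : Space N) :
    along X2 (H N (l + 1)) x = ((l : ℝ) + 3) * H N (l + 3) x := by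
  obtain ⟨B, hB⟩ := hX2.lax
  have h : (B x * L x * L x ^ l).trace = (L x * B x * L x ^ l).trace := by
    rw [mul_assoc, mul_assoc, ← pow_succ', Matrix.trace_mul_comm (L x), mul_assoc, ← pow_succ]
  rw [along, fderiv_H, hB, add_mul, sub_mul, Matrix.trace_add, Matrix.trace_sub, h, sub_self,
    zero_add, ← pow_add, add_comm 3 l, trace_L_pow]
  push_cast
  ring

theorem a_X1 (x : Space N) (n : ℕ) : a (X1 N x) (n + 1) = adot x (n + 1) := by
  by_cases h : n < N - 1
  · exact a_succ (X1 N x) ⟨n, h⟩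
  · rw [adot, a_of_le _ (by omega), a_of_le _ (by omega)]
    ring

theorem b_X1 (x : Space N) {n : ℕ} (hn : n < N) : b (X1 N x) (n + 1) = bdot x (n + 1) :=
  b_succ (X1 N x) ⟨n, hn⟩

theorem along_X1 (l : ℕ) (x : Space N) :
    along (X1 N) (H N (l + 1)) x = ((l : ℝ) + 2) * H N (l + 2) x := by
  have hM := L_pow_transpose x l
  have hc : L x * L x ^ l = L x ^ l * L x := by rw [← pow_succ', pow_succ]
  have ht := trace_L_pow x (l + 1)
  rw [show l + 1 + 1 = l + 2 from rfl] at ht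
  push_cast at ht
  rw [along, fderiv_H, trace_L_mul _ hM, show (l : ℝ) + 2 = l + 1 + 1 by ring, ← ht,
    trace_eq_sum_entry, ← sub_eq_zero, ← Finset.sum_sub_distrib]
  set M := L x ^ l with hMdef
  -- A discrete primitive of the summand. Every term has the factor `a x n`, so the boundary values
  -- at `0` and `N` vanish.
  have key := Finset.sum_range_sub (fun n => ((n : ℝ) + 1) * (2 * a x n ^ 2 * entry M (n + 1) (n + 1))
    - ((n : ℝ) + 3 / 2) * (2 * a x n * a x (n + 1) * entry M n (n + 2))
    + 1 / 2 * (2 * a x (n - 1) * a x n * entry M (n - 1) (n + 1))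
    + a x n * (b x n + b x (n + 1)) * entry M n (n + 1)) N
  simp only [a_of_le x le_rfl, a_zero] at key
  refine Eq.trans (Finset.sum_congr rfl fun n hn => ?_) (key.trans (by ring))
  rw [Finset.mem_range] at hn
  rw [a_X1 x n, b_X1 x hn, pow_succ', pow_succ', ← hMdef, entry_L_mul, entry_L_mul x M]
  have r0 := entry_L_mul x M n (n + 2)
  have r1 := entry_mul_L x hM hc (n + 1) (n + 1)
  have s : ∀ i j, entry M i j = entry M j i := entry_comm hM
  -- The factor `a x n` covers the case `n = 0`, where the row recurrence is not available.
  have r2 : a x n * entry (L x * M) n (n + 1) = a x n * (a x (n - 1) * entry M (n - 1) (n + 1)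
      + b x n * entry M n (n + 1) + a x n * entry M (n + 1) (n + 1)) := by
    cases n with
    | zero => simp [a_zero]
    | succ n => rw [entry_L_mul]; rfl
  have r3 := entry_L_mul x M (n + 1) (n + 1)
  -- The row and column expansions of the entry `(n + 1, n + 2)` agree: this is where `L * M = M *
  -- L` enters.
  have r4 := r0.symm.trans r1
  rw [mul_add, r2, r3]
  simp only [adot, bdot, Nat.add_sub_cancel]
  push_cast
  rw [s (n + 1 + 2) (n + 1), s (n + 1 + 1) (n + 1)]
  linear_combination (-2 * a x (n + 1) * ((n : ℝ) + 2)) * r4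

/-- For `k ≥ 3`, applying `[X_1, X_{k-1}]` to `H_l` gives the coefficient `(l + k - 1)(l + k) - (l +
1)(l + k) = (k - 2)(l + k)`, and `k - 2` is the normalisation of `X_k`. -/
theorem along_masterSymm {X2 : VField N} (hX2 : IsX2 X2) {k : ℕ} (hk : 1 ≤ k) (l : ℕ)
    (x : Space N) :
    along (masterSymm X2 k) (H N (l + 1)) x = ((l : ℝ) + 1 + k) * H N (l + 1 + k) x := by
  match k with
  | 1 =>
    rw [masterSymm, along_X1]
    push_cast
    ring_nf
  | 2 =>
    rw [masterSymm, along_X2 hX2]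
    push_cast
    ring_nf
  | n + 3 =>
    have ih : ∀ l, along (masterSymm X2 (n + 2)) (H N (l + 1))
        = fun x => ((l : ℝ) + 1 + (n + 2 : ℕ)) * H N (l + 1 + (n + 2)) x := fun l => by
      funext x; exact along_masterSymm hX2 (by omega) l x
    have ih1 : ∀ l, along (X1 N) (H N (l + 1)) = fun x => ((l : ℝ) + 2) * H N (l + 2) x :=
      fun l => by funext x; exact along_X1 l x
    have hd : ∀ l, DifferentiableAt ℝ (H N l) x := fun l =>
      (contDiff_H l).differentiable (by simp) x
    have hmul : ∀ (X : VField N) (c : ℝ) (l : ℕ),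
        along X (fun x => c * H N l x) x = c * along X (H N l) x := fun X c l => by
      unfold along
      rw [fderiv_const_mul (hd l)]
      simp
    have e1 := congrFun (ih1 (l + 1 + (n + 1))) x
    have e2 := congrFun (ih (l + 1)) x
    rw [show l + 1 + (n + 1) + 1 = l + 1 + (n + 2) by ring] at e1
    rw [show l + 1 + 1 = l + 2 by ring] at e2
    unfold along masterSymm
    rw [map_smul, along_lieBracket ((contDiff_X1 N).differentiable (by simp))
      ((contDiff_masterSymm hX2 (n + 2)).differentiable (by simp)) (contDiff_H _), ih, ih1,
      hmul, hmul, e1, e2, show l + 1 + (n + 1) + 2 = l + 1 + (n + 3) by ring,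
      show l + 2 + (n + 2) = l + 1 + (n + 3) by ring]
    have : (n : ℝ) + 1 ≠ 0 := by positivity
    push_cast
    simp only [smul_eq_mul]
    field_simp
    ring

/-! ### Involution and its passage through the deformation rule. -/

theorem bracket_eq_sum (P : Tensor N) (f g : Space N → ℝ) (x : Space N) :
    bracket P f g x = ∑ i, grad f x i * (P x).mulVec (grad g x) i := by
  simp only [bracket, Matrix.mulVec, dotProduct, Finset.mul_sum]
  exact Finset.sum_congr rfl fun i _ => Finset.sum_congr rfl fun j _ => by ring

theorem bracket_antisymm {P : Tensor N} (hP : ∀ x i j, P x j i = -P x i j)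
    (f g : Space N → ℝ) (x : Space N) : bracket P f g x = -bracket P g f x := by
  unfold bracket
  rw [Finset.sum_comm, ← Finset.sum_neg_distrib]
  refine Finset.sum_congr rfl fun i _ => ?_
  rw [← Finset.sum_neg_distrib]
  refine Finset.sum_congr rfl fun j _ => ?_
  rw [hP x i j]
  ring

theorem bracket_const_mul_left {P : Tensor N} {f g : Space N → ℝ} (hf : Differentiable ℝ f)
    (c : ℝ) (x : Space N) : bracket P (fun y => c * f y) g x = c * bracket P f g x := by
  have : ∀ i, grad (fun y => c * f y) x i = c * grad f x i := fun i => by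
    unfold grad; rw [fderiv_const_mul (hf x)]; simp
  simp only [bracket, this, Finset.mul_sum]
  exact Finset.sum_congr rfl fun i _ => Finset.sum_congr rfl fun j _ => by ring

theorem bracket_const_mul_right {P : Tensor N} {f g : Space N → ℝ} (hg : Differentiable ℝ g)
    (c : ℝ) (x : Space N) : bracket P f (fun y => c * g y) x = c * bracket P f g x := by
  have : ∀ i, grad (fun y => c * g y) x i = c * grad g x i := fun i => by
    unfold grad; rw [fderiv_const_mul (hg x)]; simp
  simp only [bracket, this, Finset.mul_sum]
  exact Finset.sum_congr rfl fun i _ => Finset.sum_congr rfl fun j _ => by ring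

/-- Any two of the functions `H_i` are in involution with respect to `P`. -/
def Involutive (P : Tensor N) : Prop :=
  ∀ i j x, bracket P (H N (i + 1)) (H N (j + 1)) x = 0

theorem Involutive.deform {X2 : VField N} (hX2 : IsX2 X2) {m k : ℕ} {P Q : Tensor N}
    (hP : Involutive P) (hPd : ∀ i j, ContDiff ℝ ∞ (fun x => P x i j)) (hk : 1 ≤ k)
    (hmk : m ≠ k + 2)
    (equiv : IsTrivial (fun x =>
      lieDeriv (masterSymm X2 k) P x - ((m : ℝ) - (k : ℝ) - 2) • Q x)) : Involutive Q := by
  intro i j x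
  have hd : ∀ l, Differentiable ℝ (H N l) := fun l => (contDiff_H l).differentiable (by simp)
  have hal : ∀ l, along (masterSymm X2 k) (H N (l + 1))
      = fun x => ((l : ℝ) + 1 + k) * H N ((l + k) + 1) x := fun l => by
    funext x
    rw [along_masterSymm hX2 hk, show l + k + 1 = l + 1 + k by ring]
  have h1 : bracket (lieDeriv (masterSymm X2 k) P) (H N (i + 1)) (H N (j + 1)) x = 0 := by
    rw [bracket_lieDeriv ((contDiff_masterSymm hX2 k).differentiable (by simp))
      (fun i j => (hPd i j).differentiable (by simp)) (contDiff_H _) (contDiff_H _), hal, hal,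
      bracket_const_mul_left (hd _), bracket_const_mul_right (hd _), hP, hP,
      show bracket P (H N (i + 1)) (H N (j + 1)) = fun _ => 0 from funext (hP i j), along]
    simp
  -- Triviality is needed only on the second argument: on `dH_{j+1}` the Lie derivative and the
  -- multiple of `Q` coincide.
  have h2 := equiv (j + 1) (by omega) x
  rw [Matrix.sub_mulVec, Matrix.smul_mulVec, sub_eq_zero] at h2
  have hc : (m : ℝ) - k - 2 ≠ 0 := by
    intro h
    apply hmk
    have : (m : ℝ) = k + 2 := by linarith
    exact_mod_cast this
  rw [bracket_eq_sum, h2] at h1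
  simp only [Pi.smul_apply, smul_eq_mul] at h1
  rw [bracket_eq_sum]
  refine (mul_eq_zero.1 ?_).resolve_left hc
  rw [← h1, Finset.mul_sum]
  exact Finset.sum_congr rfl fun i _ => by ring

theorem contDiff_linear (i j : Idx N) : ContDiff ℝ ∞ (fun x => linear N x i j) := by
  have ha := contDiff_a (N := N)
  rcases i with i | i <;> rcases j with j | j <;> simp only [linear, skew] <;> split_ifs <;>
    fun_prop

theorem contDiff_cubic (i j : Idx N) : ContDiff ℝ ∞ (fun x => cubic N x i j) := by
  have ha := contDiff_a (N := N)
  have hb := contDiff_b (N := N)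
  rcases i with i | i <;> rcases j with j | j <;> simp only [cubic, skew] <;> split_ifs <;>
    fun_prop

theorem IsPi.contDiff {X2 : VField N} {n : ℕ} {P : Tensor N} (hP : IsPi X2 n P) (i j : Idx N) :
    ContDiff ℝ ∞ (fun x => P x i j) := by
  cases hP with
  | linear => exact contDiff_linear i j
  | quadratic => exact contDiff_quadratic i j
  | cubic => exact contDiff_cubic i j
  | deform m k P Q hP hk hmk smooth => exact smooth i j

/-! ### Magri's argument. -/

/-- Magri's argument: the integrals are in involution with respect to both tensors of a Lenard
recursion. -/
theorem involutive_of_recursion {P Q : Tensor N} (hP : ∀ x i j, P x j i = -P x i j)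
    (hQ : ∀ x i j, Q x j i = -Q x i j)
    (h : ∀ l x, (P x).mulVec (grad (H N (l + 2)) x) = (Q x).mulVec (grad (H N (l + 1)) x)) :
    Involutive P ∧ Involutive Q := by
  have e : ∀ (f : Space N → ℝ) l x, bracket P f (H N (l + 2)) x = bracket Q f (H N (l + 1)) x :=
    fun f l x => by rw [bracket_eq_sum, bracket_eq_sum, h]
  -- Passing from `P` to `Q` and back, with antisymmetry in between, moves one unit of index from
  -- the right argument to the left.
  have shift : ∀ i j x, bracket P (H N (i + 1)) (H N (j + 2)) x
      = bracket P (H N (i + 2)) (H N (j + 1)) x := fun i j x => by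
    rw [e, bracket_antisymm hQ, ← e, bracket_antisymm hP, neg_neg]
  have diag : ∀ k i j x, bracket P (H N (i + 1)) (H N (j + k + 1)) x
      = bracket P (H N (i + k + 1)) (H N (j + 1)) x := fun k => by
    induction k with
    | zero => intros; rfl
    | succ k ih =>
      intro i j x
      rw [show j + (k + 1) + 1 = j + k + 2 by ring, shift, show i + 2 = i + 1 + 1 by ring, ih,
        show i + 1 + k + 1 = i + (k + 1) + 1 by ring]
  have zero : Involutive P := by
    have aux : ∀ i k x, bracket P (H N (i + 1)) (H N (i + k + 1)) x = 0 := fun i k x => by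
      -- Moving the whole difference `k` exchanges the two arguments, so the bracket equals its own
      -- negative.
      have h1 := diag k i i x
      have h2 := bracket_antisymm hP (H N (i + 1)) (H N (i + k + 1)) x
      linarith
    intro i j x
    rcases le_total i j with hij | hij
    · obtain ⟨k, rfl⟩ := Nat.exists_eq_add_of_le hij
      exact aux i k x
    · obtain ⟨k, rfl⟩ := Nat.exists_eq_add_of_le hij
      rw [bracket_antisymm hP, aux, neg_zero]
  exact ⟨zero, fun i j x => (e _ j x).symm.trans (zero i (j + 1) x)⟩

/-! ### Lenard relations for the three explicit brackets. -/

theorem sum_ite_succ_mul (K : ℕ) (w : ℝ) {g : ℕ → ℝ} (c : ℕ) (h : c = 0 ∨ K < c → g c = 0) :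
    ∑ j : Fin K, (if (j : ℕ) + 1 = c then w else 0) * g (j + 1) = w * g c := by
  simp only [ite_mul, zero_mul]
  exact sum_ite_succ_eq K (fun n => w * g n) c fun hc => by rw [h hc, mul_zero]

/-- The common shape of the linear, the quadratic and the cubic bracket. -/
def banded (N : ℕ) (A B₀ B₁ B₂ B₃ C : ℕ → ℝ) : Matrix (Idx N) (Idx N) ℝ := skew
  (fun i j => if j = i + 1 then A i else 0)
  (fun i j => if j = i then B₀ i else if j = i + 1 then B₁ i else if j = i + 2 then B₂ i
    else if i = j + 1 then B₃ j else 0)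
  (fun i j => if j = i + 1 then C i else 0)

section

variable (A B₀ B₁ B₂ B₃ C : ℕ → ℝ) {u d : ℕ → ℝ} {v : Space N}

theorem banded_mulVec_inl (hu : ∀ j : Fin (N - 1), v (.inl j) = u (j + 1))
    (hd : ∀ j : Fin N, v (.inr j) = d (j + 1)) (hu0 : u 0 = 0) (hun : ∀ n, N ≤ n → u n = 0)
    (hd0 : d 0 = 0) (hdn : ∀ n, N < n → d n = 0) (i : Fin (N - 1)) :
    (banded N A B₀ B₁ B₂ B₃ C).mulVec v (.inl i)
      = A (i + 1) * u (i + 2) - A i * u i + B₀ (i + 1) * d (i + 1) + B₁ (i + 1) * d (i + 2)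
        + B₂ (i + 1) * d (i + 3) + B₃ i * d i := by
  have h1 : ∀ j : Fin (N - 1), banded N A B₀ B₁ B₂ B₃ C (.inl i) (.inl j) * v (.inl j)
      = (if (j : ℕ) + 1 = i + 2 then A (i + 1) else 0) * u (j + 1)
        + (if (j : ℕ) + 1 = i then -A i else 0) * u (j + 1) := by
    intro j
    rw [hu, ← add_mul]
    congr 1
    simp only [banded, skew, Fin.lt_def]
    split_ifs <;> first | omega | simp
    next h => rw [← h]
  have h2 : ∀ j : Fin N, banded N A B₀ B₁ B₂ B₃ C (.inl i) (.inr j) * v (.inr j)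
      = (if (j : ℕ) + 1 = i + 1 then B₀ (i + 1) else 0) * d (j + 1)
        + (if (j : ℕ) + 1 = i + 2 then B₁ (i + 1) else 0) * d (j + 1)
        + (if (j : ℕ) + 1 = i + 3 then B₂ (i + 1) else 0) * d (j + 1)
        + (if (j : ℕ) + 1 = i then B₃ i else 0) * d (j + 1) := by
    intro j
    rw [hd, ← add_mul, ← add_mul, ← add_mul]
    congr 1
    simp only [banded, skew]
    split_ifs <;> first | omega | simp
    next h => rw [← h]
  rw [Matrix.mulVec, dotProduct, Fintype.sum_sum_type, Finset.sum_congr rfl fun j _ => h1 j,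
    Finset.sum_congr rfl fun j _ => h2 j]
  simp only [Finset.sum_add_distrib]
  have hu' : ∀ c, c = 0 ∨ N - 1 < c → u c = 0 := fun c hc => by
    rcases hc with rfl | hc
    exacts [hu0, hun c (by omega)]
  have hd' : ∀ c, c = 0 ∨ N < c → d c = 0 := fun c hc => by
    rcases hc with rfl | hc
    exacts [hd0, hdn c hc]
  rw [sum_ite_succ_mul _ _ _ (hu' _), sum_ite_succ_mul _ _ _ (hu' _),
    sum_ite_succ_mul _ _ _ (hd' _), sum_ite_succ_mul _ _ _ (hd' _),
    sum_ite_succ_mul _ _ _ (hd' _), sum_ite_succ_mul _ _ _ (hd' _)]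
  ring

/-- The truncated `i - 1` is harmless at `i = 0`, because its term then carries `u 0 = 0`. -/
theorem banded_mulVec_inr (hu : ∀ j : Fin (N - 1), v (.inl j) = u (j + 1))
    (hd : ∀ j : Fin N, v (.inr j) = d (j + 1)) (hu0 : u 0 = 0) (hun : ∀ n, N ≤ n → u n = 0)
    (hd0 : d 0 = 0) (hdn : ∀ n, N < n → d n = 0) (i : Fin N) :
    (banded N A B₀ B₁ B₂ B₃ C).mulVec v (.inr i)
      = C (i + 1) * d (i + 2) - C i * d i - B₀ (i + 1) * u (i + 1) - B₁ i * u i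
        - B₂ (i - 1) * u (i - 1) - B₃ (i + 1) * u (i + 2) := by
  have h1 : ∀ j : Fin (N - 1), banded N A B₀ B₁ B₂ B₃ C (.inr i) (.inl j) * v (.inl j)
      = (if (j : ℕ) + 1 = i + 1 then -B₀ (i + 1) else 0) * u (j + 1)
        + (if (j : ℕ) + 1 = i then -B₁ i else 0) * u (j + 1)
        + (if (j : ℕ) + 1 = i - 1 then -B₂ (i - 1) else 0) * u (j + 1)
        + (if (j : ℕ) + 1 = i + 2 then -B₃ (i + 1) else 0) * u (j + 1) := by
    intro j
    rw [hu, ← add_mul, ← add_mul, ← add_mul]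
    congr 1
    simp only [banded, skew]
    split_ifs <;> first | omega | simp
    all_goals congr 1
  have h2 : ∀ j : Fin N, banded N A B₀ B₁ B₂ B₃ C (.inr i) (.inr j) * v (.inr j)
      = (if (j : ℕ) + 1 = i + 2 then C (i + 1) else 0) * d (j + 1)
        + (if (j : ℕ) + 1 = i then -C i else 0) * d (j + 1) := by
    intro j
    rw [hd, ← add_mul]
    congr 1
    simp only [banded, skew, Fin.lt_def]
    split_ifs <;> first | omega | simp
    next h => rw [← h]
  rw [Matrix.mulVec, dotProduct, Fintype.sum_sum_type, Finset.sum_congr rfl fun j _ => h1 j,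
    Finset.sum_congr rfl fun j _ => h2 j]
  simp only [Finset.sum_add_distrib]
  have hu' : ∀ c, c = 0 ∨ N - 1 < c → u c = 0 := fun c hc => by
    rcases hc with rfl | hc
    exacts [hu0, hun c (by omega)]
  have hd' : ∀ c, c = 0 ∨ N < c → d c = 0 := fun c hc => by
    rcases hc with rfl | hc
    exacts [hd0, hdn c hc]
  rw [sum_ite_succ_mul _ _ _ (hu' _), sum_ite_succ_mul _ _ _ (hu' _),
    sum_ite_succ_mul _ _ _ (hu' _), sum_ite_succ_mul _ _ _ (hu' _),
    sum_ite_succ_mul _ _ _ (hd' _), sum_ite_succ_mul _ _ _ (hd' _)]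
  ring

/-- The matrix `M = L ^ l` enters through `∂H_{l+1}/∂a_n = 2 M_{n,n+1}`. -/
theorem banded_mulVec_grad_inl (l : ℕ) (x : Space N) (i : Fin (N - 1)) :
    (banded N A B₀ B₁ B₂ B₃ C).mulVec (grad (H N (l + 1)) x) (.inl i)
      = A (i + 1) * (2 * entry (L x ^ l) (i + 2) (i + 3)) - A i * (2 * entry (L x ^ l) i (i + 1))
        + B₀ (i + 1) * entry (L x ^ l) (i + 1) (i + 1)
        + B₁ (i + 1) * entry (L x ^ l) (i + 2) (i + 2)
        + B₂ (i + 1) * entry (L x ^ l) (i + 3) (i + 3) + B₃ i * entry (L x ^ l) i i :=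
  banded_mulVec_inl A B₀ B₁ B₂ B₃ C (u := fun n => 2 * entry (L x ^ l) n (n + 1))
    (d := fun n => entry (L x ^ l) n n) (grad_H_inl l x) (grad_H_inr l x)
    (by simp [entry_eq_zero]) (fun n hn => by rw [entry_eq_zero _ (by omega), mul_zero])
    (entry_eq_zero _ (by omega)) (fun n hn => entry_eq_zero _ (by omega)) i

theorem banded_mulVec_grad_inr (l : ℕ) (x : Space N) (i : Fin N) :
    (banded N A B₀ B₁ B₂ B₃ C).mulVec (grad (H N (l + 1)) x) (.inr i)
      = C (i + 1) * entry (L x ^ l) (i + 2) (i + 2) - C i * entry (L x ^ l) i i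
        - B₀ (i + 1) * (2 * entry (L x ^ l) (i + 1) (i + 2))
        - B₁ i * (2 * entry (L x ^ l) i (i + 1))
        - B₂ (i - 1) * (2 * entry (L x ^ l) (i - 1) (i - 1 + 1))
        - B₃ (i + 1) * (2 * entry (L x ^ l) (i + 2) (i + 3)) :=
  banded_mulVec_inr A B₀ B₁ B₂ B₃ C (u := fun n => 2 * entry (L x ^ l) n (n + 1))
    (d := fun n => entry (L x ^ l) n n) (grad_H_inl l x) (grad_H_inr l x)
    (by simp [entry_eq_zero]) (fun n hn => by rw [entry_eq_zero _ (by omega), mul_zero])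
    (entry_eq_zero _ (by omega)) (fun n hn => entry_eq_zero _ (by omega)) i

end

theorem linear_eq_banded (x : Space N) : linear N x = banded N 0 (fun i => -a x i) (a x) 0 0 0 := by
  simp [linear, banded]

theorem quadratic_eq_banded (x : Space N) : quadratic N x = banded N
    (fun i => 1 / 2 * a x i * a x (i + 1)) (fun i => -a x i * b x i)
    (fun i => a x i * b x (i + 1)) 0 0 (fun i => 2 * a x i ^ 2) := by
  simp [quadratic, banded]

theorem cubic_eq_banded (x : Space N) : cubic N x = banded N
    (fun i => a x i * a x (i + 1) * b x (i + 1)) (fun i => -a x i * b x i ^ 2 - a x i ^ 3)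
    (fun i => a x i * b x (i + 1) ^ 2 + a x i ^ 3) (fun i => a x i * a x (i + 1) ^ 2)
    (fun i => -a x i ^ 2 * a x (i + 1)) (fun i => 2 * a x i ^ 2 * (b x i + b x (i + 1))) := by
  rfl

theorem linear_quadratic_recursion (l : ℕ) (x : Space N) :
    (linear N x).mulVec (grad (H N (l + 2)) x) = (quadratic N x).mulVec (grad (H N (l + 1)) x) := by
  have hM := L_pow_transpose x l
  have hc : L x * L x ^ l = L x ^ l * L x := by rw [← pow_succ' (L x) l, pow_succ]
  have s : ∀ i j, entry (L x ^ l) i j = entry (L x ^ l) j i := entry_comm hM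
  rw [linear_eq_banded, quadratic_eq_banded]
  funext k
  rcases k with i | i
  · rw [banded_mulVec_grad_inl, banded_mulVec_grad_inl, pow_succ' (L x) l, entry_L_mul x _ i (i + 1),
      entry_L_mul x _ (i + 1) (i + 2)]
    simp only [Pi.zero_apply]
    rw [s (i + 2) (i + 1), s (i + 1 + 2) (i + 2)]
    ring
  -- Expanding one entry by rows and the other by columns makes the terms with `entry (L x ^ l) i (i
  -- + 2)` cancel.
  · rw [banded_mulVec_grad_inr, banded_mulVec_grad_inr, pow_succ' (L x) l, entry_L_mul x _ i (i + 2),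
      entry_mul_L x hM hc i i]
    simp only [Pi.zero_apply]
    ring

theorem quadratic_cubic_recursion (l : ℕ) (x : Space N) :
    (quadratic N x).mulVec (grad (H N (l + 2)) x) = (cubic N x).mulVec (grad (H N (l + 1)) x) := by
  have hM := L_pow_transpose x l
  have hc : L x * L x ^ l = L x ^ l * L x := by rw [← pow_succ' (L x) l, pow_succ]
  have s : ∀ i j, entry (L x ^ l) i j = entry (L x ^ l) j i := entry_comm hM
  rw [quadratic_eq_banded, cubic_eq_banded]
  funext k
  rcases k with i | i
  -- Unlike in the first relation, commutation of `L` with `L ^ l` is also needed as an equation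
  -- between the two expansions of one entry.
  · have r := (entry_L_mul x (L x ^ l) i (i + 2)).symm.trans (entry_mul_L x hM hc (i + 1) (i + 1))
    rw [banded_mulVec_grad_inl, banded_mulVec_grad_inl, pow_succ' (L x) l, entry_L_mul x _ i (i + 1),
      entry_L_mul x _ (i + 1) (i + 2), entry_L_mul x _ (i + 1) (i + 3), entry_mul_L x hM hc i i]
    simp only [Pi.zero_apply]
    rw [s (i + 2) (i + 1), s (i + 1 + 2) (i + 2)]
    linear_combination (-a x (i + 1) ^ 2) * r
  · have r : a x i * entry (L x * L x ^ l) i i = a x i * (a x (i - 1) * entry (L x ^ l) (i - 1) i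
        + b x i * entry (L x ^ l) i i + a x i * entry (L x ^ l) i (i + 1)) := by
      rcases (i : ℕ) with _ | n
      · simp [a_zero]
      · rw [entry_L_mul, s (n + 2)]; rfl
    -- `i - 1 + 1` equals `i` except at `i = 0`, where both sides contain `a x 0 = 0`.
    have r' : a x (i - 1) * a x (i - 1 + 1) ^ 2 * entry (L x ^ l) (i - 1) (i - 1 + 1)
        = a x (i - 1) * a x i ^ 2 * entry (L x ^ l) (i - 1) i := by
      rcases (i : ℕ) with _ | n
      · simp [a_zero]
      · rfl
    rw [banded_mulVec_grad_inr, banded_mulVec_grad_inr, pow_succ' (L x) l, entry_L_mul x _ i (i + 2),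
      entry_L_mul x _ (i + 1) (i + 2), entry_mul_L x hM hc i i]
    simp only [Pi.zero_apply]
    rw [s (i + 1 + 2) (i + 2)]
    linear_combination (-2 * a x i) * r + 2 * r'

/-! ### Involution along the whole hierarchy. -/

theorem involutive_linear_quadratic : Involutive (linear N) ∧ Involutive (quadratic N) :=
  involutive_of_recursion (fun _ => skew_antisymm _ _ _) (fun _ => skew_antisymm _ _ _)
    linear_quadratic_recursion

theorem involutive_cubic : Involutive (cubic N) :=
  (involutive_of_recursion (fun _ => skew_antisymm _ _ _) (fun _ => skew_antisymm _ _ _)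
    quadratic_cubic_recursion).2

theorem IsPi.involutive {X2 : VField N} (hX2 : IsX2 X2) {n : ℕ} {P : Tensor N}
    (hP : IsPi X2 n P) : Involutive P := by
  induction hP with
  | linear => exact involutive_linear_quadratic.1
  | quadratic => exact involutive_linear_quadratic.2
  | cubic => exact involutive_cubic
  | deform m k P Q hP hk hmk smooth antisymm equiv ih =>
    exact ih.deform hX2 hP.contDiff hk hmk equiv

end Toda

end

theorem proposition3 (N : ℕ) (X2 : Toda.VField N) (hX2 : Toda.IsX2 X2)
    (n : ℕ) (P : Toda.Tensor N) (hP : Toda.IsPi X2 n P)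
    (i j : ℕ) (hi : 1 ≤ i) (hj : 1 ≤ j) (x : Toda.Space N) :
    Toda.bracket P (Toda.H N i) (Toda.H N j) x = 0 := by
  have h := hP.involutive hX2 (i - 1) (j - 1) x
  rwa [Nat.sub_add_cancel hi, Nat.sub_add_cancel hj] at h
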